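/- Let $A$ be a finite alphabet with its discrete $\sigma$-algebra, and let $X=(X_i)_{i\in\mathbb Z^d}$ be the coordinates on $A^{\mathbb Z^d}$. An interaction is a family $\Phi=(\Phi_B)$, indexed by the finite $B\subset\mathbb Z^d$, of real functions $\Phi_B$ of the coordinates in $B$. Assume that $\Phi$ is absolutely summable: $\sum_{B\ni i}\|\Phi_B\|_\infty<\infty$ for every $i\in\mathbb Z^d$. For finite $\Lambda\subset\mathbb Z^d$ put $H^\Phi_\Lambda(x)=\sum_{B\cap\Lambda\neq\varnothing}\Phi_B(x)$ and $$\gamma^\Phi_\Lambda(\xi\mid x_{\Lambda^c})=\frac{\exp(-H^\Phi_\Lambda(\xi x_{\Lambda^c}))}{\sum_{\zeta\in A^\Lambda}\exp(-H^\Phi_\Lambda(\zeta x_{\Lambda^c}))},\qquad \xi\in A^\Lambda,$$ where $\xi x_{\Lambda^c}$ is the configuration equal to $\xi$ on $\Lambda$ and to $x$ off $\Lambda$. A probability measure $P$ on $A^{\mathbb Z^d}$ is a Gibbs measure for $\Phi$ if $P(X_\Lambda=\xi\mid X_{\Lambda^c})=\gamma^\Phi_\Lambda(\xi\mid X_{\Lambda^c})$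 $P$-almost surely for all finite $\Lambda$ and all $\xi\in A^\Lambda$. Write $\lim_{V\nearrow\mathbb Z^d}$ for the limit along van Hove volumes, i.e. along all sequences of nonempty finite $V\subset\mathbb Z^d$ with $|(k+V)\,\triangle\, V|/|V|\to0$ for every $k\in\mathbb Z^d$. Let $\mathrm H$ denote Shannon entropy (natural logarithm), with $\mathrm H(X_S\mid X_T)=\mathrm H(X_{S\cup T})-\mathrm H(X_T)$. For a translation-invariant probability measure $P$, the erasure entropy rate for the finite volume $\Lambda$ and the entropy density are $$h^-_\Lambda(P)=\lim_{V\nearrow\mathbb Z^d}\frac1{|V|}\sum_{k\in V}\mathrm H\bigl(X_{(k+\Lambda)\cap V}\mid X_{V\setminus(k+\Lambda)}\bigr),\qquad h(P)=\lim_{V\nearrow\mathbb Z^d}\frac1{|V|}\mathrm H(X_V).$$ **Theorem.** Let $P$ be a translation-invariant Gibbs measure for $\Phi$. Then for every finite $\Lambda\subset\mathbb Z^d$ the limit $h^-_\Lambda(P)$ exists, $\log\gamma^\Phi_\Lambda(X_\Lambda\mid X_{\Lambda^c})$ is $P$-integrable, and $$h^-_\Lambda(P)=-\int\log\gamma^\Phi_\Lambda(X_\Lambda\mid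 X_{\Lambda^c})\,dP.$$ Hence $h^-_\Lambda$ is affine on the translation-invariant Gibbs measures for $\Phi$: if $P,Q$ are two of them and $0\le t\le1$, then $tP+(1-t)Q$ is again one, and $h^-_\Lambda(tP+(1-t)Q)=t\,h^-_\Lambda(P)+(1-t)\,h^-_\Lambda(Q)$ for every finite $\Lambda$. Moreover, the limit $h(P)$ exists and $$\lim_{\Lambda\nearrow\mathbb Z^d}\frac1{|\Lambda|}\,h^-_\Lambda(P)=h(P).$$ -/

import Mathlib

open MeasureTheory Filter Topology

noncomputable section

namespace ErasureEntropy

/-- Sites of the lattice `ℤ^d`. -/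
abbrev Site (d : ℕ) : Type := Fin d → ℤ

/-- Configurations on `ℤ^d` with alphabet `A`. -/
abbrev Config (d : ℕ) (A : Type*) : Type _ := Site d → A

/-- The shifted volume `k + Λ`. -/
def translate {d : ℕ} (k : Site d) (Λ : Finset (Site d)) : Finset (Site d) :=
  Λ.image (fun i => k + i)

/-- The filter of growing finite volumes in the sense of van Hove: a sequence `V n` tends to it
iff eventually `V n` is nonempty and `|(k + V n) ∆ V n| / |V n| → 0` for every `k`. -/
def vanHove (d : ℕ) : Filter (Finset (Site d)) :=
  𝓟 {V | V.Nonempty} ⊓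
    ⨅ k : Site d, comap (fun V => ((symmDiff (translate k V) V).card : ℝ) / V.card) (𝓝 0)

/-- The cube `{0, …, n}^d`. -/
def cube (d n : ℕ) : Finset (Site d) := Fintype.piFinset (fun _ => Finset.Ico (0 : ℤ) (n + 1))

theorem card_cube (d n : ℕ) : (cube d n).card = (n + 1) ^ d := by
  simp only [cube, Fintype.card_piFinset, Int.card_Ico, Finset.prod_const, Finset.card_univ,
    Fintype.card_fin]
  congr 1

theorem card_translate {d : ℕ} (k : Site d) (Λ : Finset (Site d)) :
    (translate k Λ).card = Λ.card :=
  Finset.card_image_of_injective _ (add_right_injective k)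

/-- The cubes are a van Hove sequence. -/
theorem tendsto_cube (d : ℕ) : Tendsto (cube d) atTop (vanHove d) := by
  refine tendsto_inf.2 ⟨?_, tendsto_iInf.2 fun k => tendsto_comap_iff.2 ?_⟩
  · refine tendsto_principal.2 (Eventually.of_forall fun n => ?_)
    exact Finset.card_pos.1 (by rw [card_cube]; positivity)
  have hlim : Tendsto (fun n : ℕ => 2 * (1 - ∏ i : Fin d, (1 - (|k i| : ℝ) / ((n : ℝ) + 1))))
      atTop (𝓝 0) := by
    have h1 : ∀ i : Fin d, Tendsto (fun n : ℕ => 1 - (|k i| : ℝ) / ((n : ℝ) + 1)) atTop (𝓝 1) := by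
      intro i
      have h := (tendsto_one_div_add_atTop_nhds_zero_nat (𝕜 := ℝ)).const_mul (|k i| : ℝ)
      have h' := h.const_sub 1
      simp only [mul_zero, sub_zero] at h'
      refine h'.congr fun n => ?_
      ring
    have h2 := tendsto_finsetProd (Finset.univ : Finset (Fin d)) (fun i _ => h1 i)
    have h3 := (h2.const_sub 1).const_mul 2
    simpa using h3
  refine tendsto_of_tendsto_of_tendsto_of_le_of_le' tendsto_const_nhds hlim
    (Eventually.of_forall fun n => by simp only [Function.comp]; positivity) ?_
  have hev : ∀ᶠ n : ℕ in atTop, ∀ i : Fin d, |k i| ≤ (n : ℤ) := by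
    rw [eventually_all]
    intro i
    filter_upwards [eventually_ge_atTop (k i).natAbs] with n hn
    rw [Int.abs_eq_natAbs]
    exact_mod_cast hn
  filter_upwards [hev] with n hn
  -- the intersection contains a cuboid with sides `n + 1 - |k i|`
  have hI : ∏ i : Fin d, ((n : ℝ) + 1 - |(k i : ℝ)|) ≤ (translate k (cube d n) ∩ cube d n).card := by
    have hsub : Fintype.piFinset (fun i => Finset.Ico (max 0 (k i)) (n + 1 + min 0 (k i))) ⊆
        translate k (cube d n) ∩ cube d n := by
      intro x hx
      rw [Fintype.mem_piFinset] at hx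
      rw [Finset.mem_inter]
      constructor
      · refine Finset.mem_image.2 ⟨x - k, ?_, by simp⟩
        rw [cube, Fintype.mem_piFinset]
        intro i
        have := hx i
        simp only [Finset.mem_Ico, Pi.sub_apply] at this ⊢
        omega
      · rw [cube, Fintype.mem_piFinset]
        intro i
        have := hx i
        simp only [Finset.mem_Ico] at this ⊢
        omega
    have hc := Finset.card_le_card hsub
    rw [Fintype.card_piFinset] at hc
    refine le_trans (le_of_eq ?_) (Nat.cast_le.2 hc)
    rw [Nat.cast_prod]
    refine Finset.prod_congr rfl fun i _ => ?_
    have hz : ((Finset.Ico (max 0 (k i)) (n + 1 + min 0 (k i))).card : ℤ) = n + 1 - |k i| := by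
      have := hn i
      rw [Int.card_Ico]
      rcases abs_cases (k i) with h | h <;> omega
    have hz' := congrArg (Int.cast : ℤ → ℝ) hz
    push_cast at hz'
    exact hz'.symm
  have hsymm : ((symmDiff (translate k (cube d n)) (cube d n)).card : ℝ) =
      2 * (((n : ℝ) + 1) ^ d - (translate k (cube d n) ∩ cube d n).card) := by
    have e1 := Finset.card_sdiff_add_card_inter (translate k (cube d n)) (cube d n)
    have e2 := Finset.card_sdiff_add_card_inter (cube d n) (translate k (cube d n))
    have e3 : (symmDiff (translate k (cube d n)) (cube d n)).card =
        (translate k (cube d n) \ cube d n).card + (cube d n \ translate k (cube d n)).card := by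
      rw [symmDiff, Finset.sup_eq_union, Finset.card_union_of_disjoint disjoint_sdiff_sdiff]
    rw [card_translate, card_cube] at e1
    rw [Finset.inter_comm, card_cube] at e2
    rw [e3]
    have f1 := congrArg (Nat.cast : ℕ → ℝ) e1
    have f2 := congrArg (Nat.cast : ℕ → ℝ) e2
    push_cast at f1 f2 ⊢
    linarith
  have hpos : (0 : ℝ) < (n : ℝ) + 1 := by positivity
  have hprod : ∏ i : Fin d, (1 - |(k i : ℝ)| / ((n : ℝ) + 1)) =
      (∏ i : Fin d, ((n : ℝ) + 1 - |(k i : ℝ)|)) / ((n : ℝ) + 1) ^ d := by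
    have : (((n : ℝ) + 1) ^ d) = ∏ _i : Fin d, ((n : ℝ) + 1) := by simp
    rw [this, ← Finset.prod_div_distrib]
    refine Finset.prod_congr rfl fun i _ => ?_
    field_simp
  simp only [Function.comp]
  rw [hsymm, card_cube, hprod]
  push_cast
  rw [div_le_iff₀ (by positivity)]
  have : (∏ i : Fin d, ((n : ℝ) + 1 - |(k i : ℝ)|)) / ((n : ℝ) + 1) ^ d * ((n : ℝ) + 1) ^ d =
      ∏ i : Fin d, ((n : ℝ) + 1 - |(k i : ℝ)|) := by
    field_simp
  nlinarith

instance (d : ℕ) : (vanHove d).NeBot := (tendsto_cube d).neBot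

section Entropy

variable {d : ℕ} {A : Type*} [Fintype A] [MeasurableSpace A]

/-- The Shannon entropy `H(X_V)` (natural logarithm) of the coordinates in `V`. -/
def entropy (P : Measure (Config d A)) (V : Finset (Site d)) : ℝ :=
  ∑ ξ : V → A, Real.negMulLog (P.real {x | V.restrict x = ξ})

/-- The conditional entropy `H(X_S | X_T) = H(X_{S ∪ T}) - H(X_T)`. -/
def condEntropy (P : Measure (Config d A)) (S T : Finset (Site d)) : ℝ :=
  entropy P (S ∪ T) - entropy P T

/-- `|V|⁻¹ ∑_{k ∈ V} H(X_{(k + Λ) ∩ V} | X_{V \ (k + Λ)})`. -/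
def meanErasureEntropy (P : Measure (Config d A)) (Λ V : Finset (Site d)) : ℝ :=
  (∑ k ∈ V, condEntropy P (translate k Λ ∩ V) (V \ translate k Λ)) / V.card

/-- The erasure entropy rate of `P` for the finite volume `Λ`. -/
def erasureEntropyRate (P : Measure (Config d A)) (Λ : Finset (Site d)) : ℝ :=
  limUnder (vanHove d) (meanErasureEntropy P Λ)

/-- The entropy density `lim_V |V|⁻¹ H(X_V)` of `P`. -/
def entropyDensity (P : Measure (Config d A)) : ℝ :=
  limUnder (vanHove d) (fun V => entropy P V / V.card)

end Entropy

/-- `P` is invariant under all lattice translations. -/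
def TranslationInvariant {d : ℕ} {A : Type*} [MeasurableSpace A]
    (P : Measure (Config d A)) : Prop :=
  ∀ k : Site d, P.map (fun x i => x (i + k)) = P

/-- An interaction: for every finite `B` a real function `Φ_B` of the coordinates in `B`. -/
abbrev Interaction (d : ℕ) (A : Type*) : Type _ := (B : Finset (Site d)) → (B → A) → ℝ

section Gibbs

variable {d : ℕ} {A : Type*} [Fintype A]

/-- `∑_{B ∋ i} sup |Φ_B| < ∞` for every site `i`; the norm is the sup norm on functions on the
finite set `A ^ B`. -/
def AbsolutelySummable (Φ : Interaction d A) : Prop :=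
  ∀ i : Site d, Summable (fun B : {B : Finset (Site d) // i ∈ B} => ‖Φ B.1‖)

/-- The Hamiltonian `H_Λ(x) = ∑_{B ∩ Λ ≠ ∅} Φ_B(x)`. -/
def hamiltonian (Φ : Interaction d A) (Λ : Finset (Site d)) (x : Config d A) : ℝ :=
  ∑' B : {B : Finset (Site d) // (B ∩ Λ).Nonempty}, Φ B.1 (B.1.restrict x)

/-- The configuration equal to `ξ` on `Λ` and to `x` off `Λ`. -/
def glue (Λ : Finset (Site d)) (ξ : Λ → A) (x : Config d A) : Config d A :=
  fun i => if h : i ∈ Λ then ξ ⟨i, h⟩ else x i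

/-- The partition function `Z_Λ`; it depends on `x` only off `Λ`. -/
def partitionFunction (Φ : Interaction d A) (Λ : Finset (Site d)) (x : Config d A) : ℝ :=
  ∑ ξ : Λ → A, Real.exp (-hamiltonian Φ Λ (glue Λ ξ x))

/-- The Gibbs specification `γ_Λ(ξ | x_{Λᶜ})`. -/
def gibbsSpec (Φ : Interaction d A) (Λ : Finset (Site d)) (ξ : Λ → A) (x : Config d A) : ℝ :=
  Real.exp (-hamiltonian Φ Λ (glue Λ ξ x)) / partitionFunction Φ Λ x

/-- `P` is a Gibbs measure for `Φ`: a probability measure such that, for every finite volume `Λ`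
and every `ξ ∈ A ^ Λ`, the conditional probability of `X_Λ = ξ` given the σ-algebra generated by
the coordinates off `Λ` is `γ_Λ(ξ | X_{Λᶜ})`. -/
structure IsGibbs [MeasurableSpace A] (Φ : Interaction d A) (P : Measure (Config d A)) :
    Prop where
  isProbabilityMeasure : IsProbabilityMeasure P
  dlr : ∀ (Λ : Finset (Site d)) (ξ : Λ → A),
    P[Set.indicator {x | Λ.restrict x = ξ} (fun _ => (1 : ℝ)) |
      cylinderEvents ((Λ : Set (Site d))ᶜ)] =ᵐ[P] gibbsSpec Φ Λ ξ

end Gibbs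

end ErasureEntropy

end

open ErasureEntropy

/-! Absolute summability makes the specification quasilocal: two boundary conditions that agree on
`T` give values of `log γ_Λ` differing by at most `4 * tail Φ Λ (Λ ∪ T)`, and this tail vanishes as
`T` grows (`gibbsSpec_le`, `tendsto_tail`). Integrating the DLR equation over a cylinder on `T`
shows that the conditional probability of `x_Λ` given `x_T` is `γ_Λ` up to the same error in the
logarithm (`IsGibbs.abs_log_pr_union_sub_le`). Hence `H(X_Λ | X_{U \ Λ})` tends to `-∫ log γ_Λ dP`
as `U` exhausts the lattice. By translation invariance the summand at `k` in the mean erasure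
entropy is a function of `V - k`, and most sites of a van Hove volume see a large window around them
inside `V`, so the average has the same limit (`tendsto_average_vanHove`). Affinity follows, since
the integrand does not involve `P` and the DLR equations are linear in `P`.

For the entropy density, the chain rule in lexicographic order again gives an average of a function
of `V - k`, this time a decreasing nonnegative one. The erasure rate is at most `H(X_Λ)`, because
conditioning reduces entropy, and at least `H(X_Λ)` minus a boundary term of order `o(|Λ|)`: up to
the exponential of that term, the joint law of `X_Λ` and `X_T` is dominated by the product of its
marginals (`IsGibbs.log_pr_union_le`). -/

namespace ErasureEntropy

/-! ### Gluing configurations. -/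

section Glue

variable {d : ℕ} {A : Type*}

theorem glue_of_mem {Λ : Finset (Site d)} (ξ : Λ → A) (x : Config d A) {i : Site d} (h : i ∈ Λ) :
    glue Λ ξ x i = ξ ⟨i, h⟩ := dif_pos h

theorem glue_of_notMem {Λ : Finset (Site d)} (ξ : Λ → A) (x : Config d A) {i : Site d}
    (h : i ∉ Λ) : glue Λ ξ x i = x i := dif_neg h

@[simp]
theorem restrict_glue (Λ : Finset (Site d)) (ξ : Λ → A) (x : Config d A) :
    Λ.restrict (glue Λ ξ x) = ξ := by
  ext i
  exact glue_of_mem ξ x i.2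

@[simp]
theorem glue_restrict (Λ : Finset (Site d)) (x : Config d A) : glue Λ (Λ.restrict x) x = x := by
  ext i
  by_cases h : i ∈ Λ
  · rw [glue_of_mem _ _ h]; rfl
  · rw [glue_of_notMem _ _ h]

/-- The coordinates in `Λ` are overwritten, so only the exterior σ-algebra is needed; this is what
makes `gibbsSpec` exterior-measurable. -/
theorem measurable_glue [MeasurableSpace A] (Λ : Finset (Site d)) (ξ : Λ → A) :
    Measurable[cylinderEvents ((Λ : Set (Site d))ᶜ)] (fun x : Config d A => glue Λ ξ x) := by
  refine (@measurable_pi_iff _ _ _ (cylinderEvents _) _ _).2 fun i => ?_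
  by_cases h : i ∈ Λ
  · simp only [glue_of_mem _ _ h]
    exact measurable_const
  · simp only [glue_of_notMem _ _ h]
    exact measurable_cylinderEvent_apply (by simpa using h)

end Glue

/-! ### Quasilocality of the Gibbs specification. -/

section Energy

variable {d : ℕ} {A : Type*} [Fintype A]

/-- The total norm of the part of the interaction that meets `Λ` and is not contained in `U`. -/
noncomputable def tail (Φ : Interaction d A) (Λ U : Finset (Site d)) : ℝ :=
  ∑' B : {B : Finset (Site d) // (B ∩ Λ).Nonempty}, if B.1 ⊆ U then 0 else ‖Φ B.1‖

/-- The conditional probability, under the Gibbs specification, of the configuration in `Λ` given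
the configuration off `Λ`. -/
noncomputable def gibbsDensity (Φ : Interaction d A) (Λ : Finset (Site d)) (x : Config d A) : ℝ :=
  gibbsSpec Φ Λ (Λ.restrict x) x

/-- A set meeting `Λ` contains some `i ∈ Λ`, so the family is dominated by the finite sum over `i ∈
Λ` of the families assumed summable. -/
theorem summable_norm_of_meets {Φ : Interaction d A} (hΦ : AbsolutelySummable Φ)
    (Λ : Finset (Site d)) :
    Summable (fun B : {B : Finset (Site d) // (B ∩ Λ).Nonempty} => ‖Φ B.1‖) := by
  have h1 : ∀ i ∈ Λ, Summable (Set.indicator {B : Finset (Site d) | i ∈ B} fun B => ‖Φ B‖) :=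
    fun i _ => summable_subtype_iff_indicator.1 (hΦ i)
  have h2 := summable_sum h1
  refine (summable_subtype_iff_indicator (s := {B : Finset (Site d) | (B ∩ Λ).Nonempty})
    (f := fun B => ‖Φ B‖)).2 ?_
  refine Summable.of_nonneg_of_le (fun B => Set.indicator_nonneg (fun _ _ => norm_nonneg _) _)
    (fun B => ?_) h2
  by_cases hB : (B ∩ Λ).Nonempty
  · obtain ⟨i, hi⟩ := id hB
    rw [Finset.mem_inter] at hi
    rw [Set.indicator_of_mem (s := {B : Finset (Site d) | (B ∩ Λ).Nonempty}) hB]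
    refine le_trans (le_of_eq ?_) (Finset.single_le_sum
      (f := fun i => Set.indicator {B : Finset (Site d) | i ∈ B} (fun B => ‖Φ B‖) B)
      (fun j _ => Set.indicator_nonneg (fun _ _ => norm_nonneg _) _) hi.2)
    exact (Set.indicator_of_mem (s := {B : Finset (Site d) | i ∈ B}) hi.1 (fun B => ‖Φ B‖)).symm
  · rw [Set.indicator_of_notMem (s := {B : Finset (Site d) | (B ∩ Λ).Nonempty}) hB]
    exact Finset.sum_nonneg fun j _ => Set.indicator_nonneg (fun _ _ => norm_nonneg _) _

theorem summable_tail {Φ : Interaction d A} (hΦ : AbsolutelySummable Φ) (Λ U : Finset (Site d)) :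
    Summable (fun B : {B : Finset (Site d) // (B ∩ Λ).Nonempty} =>
      if B.1 ⊆ U then 0 else ‖Φ B.1‖) := by
  refine Summable.of_nonneg_of_le (fun B => ?_) (fun B => ?_) (summable_norm_of_meets hΦ Λ)
  · split_ifs <;> positivity
  · split_ifs <;> simp

theorem tail_nonneg (Φ : Interaction d A) (Λ U : Finset (Site d)) : 0 ≤ tail Φ Λ U :=
  tsum_nonneg fun B => by split_ifs <;> positivity

theorem tail_antitone {Φ : Interaction d A} (hΦ : AbsolutelySummable Φ) (Λ : Finset (Site d)) :
    Antitone (tail Φ Λ) := by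
  intro U V h
  refine Summable.tsum_le_tsum (fun B => ?_) (summable_tail hΦ Λ V) (summable_tail hΦ Λ U)
  by_cases hB : B.1 ⊆ U
  · rw [if_pos hB, if_pos (hB.trans h)]
  · rw [if_neg hB]
    split_ifs <;> simp

theorem tendsto_tail {Φ : Interaction d A} (hΦ : AbsolutelySummable Φ) (Λ : Finset (Site d)) :
    Tendsto (tail Φ Λ) atTop (𝓝 0) := by
  have h := tendsto_tsum_of_dominated_convergence (𝓕 := (atTop : Filter (Finset (Site d))))
    (f := fun U (B : {B : Finset (Site d) // (B ∩ Λ).Nonempty}) =>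
      if B.1 ⊆ U then 0 else ‖Φ B.1‖) (g := fun _ => 0) (summable_norm_of_meets hΦ Λ)
    (fun B => ?_) (Eventually.of_forall fun U B => ?_)
  · rw [tsum_zero] at h
    exact h
  · refine tendsto_const_nhds.congr' ?_
    filter_upwards [eventually_ge_atTop B.1] with U hU
    rw [if_pos hU]
  · split_ifs <;> simp

theorem summable_hamiltonian {Φ : Interaction d A} (hΦ : AbsolutelySummable Φ)
    (Λ : Finset (Site d)) (x : Config d A) :
    Summable (fun B : {B : Finset (Site d) // (B ∩ Λ).Nonempty} => Φ B.1 (B.1.restrict x)) :=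
  Summable.of_norm_bounded (summable_norm_of_meets hΦ Λ) fun B => norm_le_pi_norm (Φ B.1) _

theorem abs_hamiltonian_sub_le {Φ : Interaction d A} (hΦ : AbsolutelySummable Φ)
    (Λ U : Finset (Site d)) {x y : Config d A} (h : ∀ i ∈ U, x i = y i) :
    |hamiltonian Φ Λ x - hamiltonian Φ Λ y| ≤ 2 * tail Φ Λ U := by
  rw [hamiltonian, hamiltonian, ← (summable_hamiltonian hΦ Λ x).tsum_sub
    (summable_hamiltonian hΦ Λ y), tail, ← tsum_mul_left, ← Real.norm_eq_abs]
  -- Terms with `B ⊆ U` cancel; each other term costs at most twice its norm.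
  refine tsum_of_norm_bounded ((summable_tail hΦ Λ U).mul_left 2).hasSum fun B => ?_
  split_ifs with hB
  · have : B.1.restrict x = B.1.restrict y := by
      ext i
      exact h i (hB i.2)
    simp [this]
  · refine (norm_sub_le _ _).trans ?_
    have h1 := norm_le_pi_norm (Φ B.1) (B.1.restrict x)
    have h2 := norm_le_pi_norm (Φ B.1) (B.1.restrict y)
    linarith

theorem partitionFunction_pos (Φ : Interaction d A) (Λ : Finset (Site d)) (x : Config d A) :
    0 < partitionFunction Φ Λ x :=
  Finset.sum_pos (fun _ _ => Real.exp_pos _) ⟨Λ.restrict x, Finset.mem_univ _⟩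

theorem gibbsSpec_pos (Φ : Interaction d A) (Λ : Finset (Site d)) (ξ : Λ → A) (x : Config d A) :
    0 < gibbsSpec Φ Λ ξ x :=
  div_pos (Real.exp_pos _) (partitionFunction_pos Φ Λ x)

theorem gibbsSpec_le_one (Φ : Interaction d A) (Λ : Finset (Site d)) (ξ : Λ → A)
    (x : Config d A) : gibbsSpec Φ Λ ξ x ≤ 1 :=
  (div_le_one (partitionFunction_pos Φ Λ x)).2 <|
    Finset.single_le_sum (f := fun ξ => Real.exp (-hamiltonian Φ Λ (glue Λ ξ x)))
      (fun _ _ => (Real.exp_pos _).le) (Finset.mem_univ ξ)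

/-- The numerator and the partition function each contribute a factor `exp (2 * tail)`. -/
theorem gibbsSpec_le {Φ : Interaction d A} (hΦ : AbsolutelySummable Φ)
    (Λ T : Finset (Site d)) (ξ : Λ → A) {x y : Config d A} (h : ∀ i ∈ T, x i = y i) :
    gibbsSpec Φ Λ ξ x ≤ Real.exp (4 * tail Φ Λ (Λ ∪ T)) * gibbsSpec Φ Λ ξ y := by
  set a := tail Φ Λ (Λ ∪ T)
  have hH : ∀ ζ : Λ → A, |hamiltonian Φ Λ (glue Λ ζ x) - hamiltonian Φ Λ (glue Λ ζ y)| ≤ 2 * a := by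
    intro ζ
    refine abs_hamiltonian_sub_le hΦ Λ (Λ ∪ T) fun i hi => ?_
    by_cases hΛ : i ∈ Λ
    · rw [glue_of_mem _ _ hΛ, glue_of_mem _ _ hΛ]
    · rw [glue_of_notMem _ _ hΛ, glue_of_notMem _ _ hΛ]
      exact h i ((Finset.mem_union.1 hi).resolve_left hΛ)
  have hnum : Real.exp (-hamiltonian Φ Λ (glue Λ ξ x)) ≤
      Real.exp (2 * a) * Real.exp (-hamiltonian Φ Λ (glue Λ ξ y)) := by
    rw [← Real.exp_add, Real.exp_le_exp]
    have := abs_le.1 (hH ξ)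
    linarith
  have hden : partitionFunction Φ Λ y ≤ Real.exp (2 * a) * partitionFunction Φ Λ x := by
    rw [partitionFunction, partitionFunction, Finset.mul_sum]
    refine Finset.sum_le_sum fun ζ _ => ?_
    rw [← Real.exp_add, Real.exp_le_exp]
    have := abs_le.1 (hH ζ)
    linarith
  have hx := partitionFunction_pos Φ Λ x
  have hy := partitionFunction_pos Φ Λ y
  rw [gibbsSpec, gibbsSpec, ← mul_div_assoc, div_le_div_iff₀ hx hy,
    show 4 * a = 2 * a + 2 * a by ring, Real.exp_add]
  calc _ ≤ (Real.exp (2 * a) * Real.exp (-hamiltonian Φ Λ (glue Λ ξ y))) *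
        (Real.exp (2 * a) * partitionFunction Φ Λ x) := by gcongr
    _ = _ := by ring

theorem gibbsDensity_pos (Φ : Interaction d A) (Λ : Finset (Site d)) (x : Config d A) :
    0 < gibbsDensity Φ Λ x := gibbsSpec_pos ..

theorem abs_log_gibbsDensity_sub_le {Φ : Interaction d A} (hΦ : AbsolutelySummable Φ)
    (Λ T : Finset (Site d)) {x y : Config d A} (h : ∀ i ∈ Λ ∪ T, x i = y i) :
    |Real.log (gibbsDensity Φ Λ x) - Real.log (gibbsDensity Φ Λ y)| ≤
      4 * tail Φ Λ (Λ ∪ T) := by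
  have key : ∀ x y : Config d A, (∀ i ∈ Λ ∪ T, x i = y i) →
      Real.log (gibbsDensity Φ Λ x) - Real.log (gibbsDensity Φ Λ y) ≤ 4 * tail Φ Λ (Λ ∪ T) := by
    intro x y h
    have hr : Λ.restrict x = Λ.restrict y := by
      ext i
      exact h i (Finset.mem_union_left _ i.2)
    have h1 := gibbsSpec_le hΦ Λ T (Λ.restrict y) fun i hi => h i (Finset.mem_union_right _ hi)
    have h2 := Real.log_le_log (gibbsSpec_pos ..) h1
    rw [Real.log_mul (Real.exp_pos _).ne' (gibbsSpec_pos ..).ne', Real.log_exp] at h2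
    rw [gibbsDensity, gibbsDensity, hr]
    linarith
  exact abs_le.2 ⟨by linarith [key y x fun i hi => (h i hi).symm], key x y h⟩

variable [MeasurableSpace A] [MeasurableSingletonClass A]

theorem measurable_hamiltonian (Φ : Interaction d A) (Λ : Finset (Site d)) :
    Measurable (hamiltonian Φ Λ) := by
  refine Measurable.tsum fun B => ?_
  exact (measurable_of_countable (Φ B.1)).comp (Finset.measurable_restrict B.1)

theorem measurable_gibbsSpec (Φ : Interaction d A) (Λ : Finset (Site d)) (ξ : Λ → A) :
    Measurable[cylinderEvents ((Λ : Set (Site d))ᶜ)] (gibbsSpec Φ Λ ξ) := by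
  have h : ∀ ζ : Λ → A, Measurable[cylinderEvents ((Λ : Set (Site d))ᶜ)]
      (fun x => Real.exp (-hamiltonian Φ Λ (glue Λ ζ x))) := fun ζ =>
    ((measurable_hamiltonian Φ Λ).comp (measurable_glue Λ ζ)).neg.exp
  exact (h ξ).div (Finset.measurable_sum _ fun ζ _ => h ζ)

theorem measurable_gibbsDensity (Φ : Interaction d A) (Λ : Finset (Site d)) :
    Measurable (gibbsDensity Φ Λ) := by
  classical
  have h : gibbsDensity Φ Λ =
      fun x => ∑ ξ : Λ → A, if Λ.restrict x = ξ then gibbsSpec Φ Λ ξ x else 0 := by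
    ext x
    rw [Finset.sum_eq_single (Λ.restrict x)]
    · rw [if_pos rfl, gibbsDensity]
    · intro ξ _ hξ
      rw [if_neg hξ.symm]
    · simp
  rw [h]
  refine Finset.measurable_sum _ fun ξ _ => Measurable.ite ?_ ?_ measurable_const
  · exact measurableSet_eq_fun (Finset.measurable_restrict Λ) measurable_const
  · exact (measurable_gibbsSpec Φ Λ ξ).mono cylinderEvents_le_pi le_rfl

end Energy

/-! ### Cylinder probabilities and Shannon entropy. -/

section Cylinder

variable {d : ℕ} {A : Type*}

/-- The cylinder set of all configurations that agree with `x` on `V`. -/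
def cyl (V : Finset (Site d)) (x : Config d A) : Set (Config d A) := {y | ∀ i ∈ V, y i = x i}

theorem mem_cyl {V : Finset (Site d)} {x y : Config d A} : y ∈ cyl V x ↔ ∀ i ∈ V, y i = x i :=
  Iff.rfl

theorem cyl_eq_restrict (V : Finset (Site d)) (x : Config d A) :
    cyl V x = {y | V.restrict y = V.restrict x} := by
  ext y
  simp [cyl, funext_iff]

theorem cyl_congr {V : Finset (Site d)} {x y : Config d A} (h : ∀ i ∈ V, x i = y i) :
    cyl V x = cyl V y := by
  ext z
  exact forall₂_congr fun i hi => by rw [h i hi]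

variable [MeasurableSpace A]

/-- The probability that a random configuration agrees with `x` on `V`. -/
noncomputable def pr (P : Measure (Config d A)) (V : Finset (Site d)) (x : Config d A) : ℝ :=
  P.real (cyl V x)

theorem pr_congr (P : Measure (Config d A)) {V : Finset (Site d)} {x y : Config d A}
    (h : ∀ i ∈ V, x i = y i) : pr P V x = pr P V y := by
  rw [pr, pr, cyl_congr h]

theorem pr_empty (P : Measure (Config d A)) [IsProbabilityMeasure P] (x : Config d A) :
    pr P ∅ x = 1 := by
  simp [pr, cyl]

theorem pr_anti (P : Measure (Config d A)) [IsFiniteMeasure P] {V W : Finset (Site d)}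
    (h : V ⊆ W) (x : Config d A) : pr P W x ≤ pr P V x :=
  measureReal_mono fun _ hy i hi => hy i (h hi)

theorem dependsOn_log_pr (P : Measure (Config d A)) (V : Finset (Site d)) :
    DependsOn (fun x => Real.log (pr P V x)) (V : Set (Site d)) :=
  fun _ _ h => congrArg Real.log (pr_congr P h)

variable [MeasurableSingletonClass A]

theorem measurableSet_cyl' {V : Finset (Site d)} {Δ : Set (Site d)} (h : (V : Set (Site d)) ⊆ Δ)
    (x : Config d A) : MeasurableSet[cylinderEvents Δ] (cyl V x) := by
  have : cyl V x = ⋂ i ∈ V, (fun y : Config d A => y i) ⁻¹' {x i} := by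
    ext y
    simp [cyl]
  rw [this]
  refine Finset.measurableSet_biInter _ fun i hi => ?_
  exact (measurable_cylinderEvent_apply (h hi)) (measurableSet_singleton _)

theorem measurableSet_cyl (V : Finset (Site d)) (x : Config d A) : MeasurableSet (cyl V x) :=
  cylinderEvents_le_pi _ (measurableSet_cyl' subset_rfl x)

theorem pr_comp_shift {P : Measure (Config d A)} (hP : TranslationInvariant P) (k : Site d)
    (V : Finset (Site d)) (x : Config d A) :
    pr P (translate k V) x = pr P V (fun i => x (i + k)) := by
  have hm : Measurable (fun (x : Config d A) i => x (i + k)) :=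
    measurable_pi_iff.2 fun i => measurable_pi_apply _
  conv_rhs => rw [pr, ← hP k]
  rw [map_measureReal_apply hm (measurableSet_cyl V _), pr]
  congr 1
  ext y
  simp only [cyl, translate, Set.mem_preimage, Set.mem_ofPred_eq, Finset.forall_mem_image,
    add_comm k]

variable [Fintype A]

theorem sum_pr_glue (P : Measure (Config d A)) [IsFiniteMeasure P] {Λ T : Finset (Site d)}
    (h : Disjoint Λ T) (x : Config d A) :
    ∑ ξ : Λ → A, pr P (Λ ∪ T) (glue Λ ξ x) = pr P T x := by
  have hU : cyl T x = ⋃ ξ ∈ (Finset.univ : Finset (Λ → A)), cyl (Λ ∪ T) (glue Λ ξ x) := by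
    ext y
    simp only [Finset.mem_univ, Set.iUnion_true, Set.mem_iUnion]
    constructor
    · intro hy
      refine ⟨Λ.restrict y, fun i hi => ?_⟩
      by_cases hΛ : i ∈ Λ
      · rw [glue_of_mem _ _ hΛ]; rfl
      · rw [glue_of_notMem _ _ hΛ]
        exact hy i ((Finset.mem_union.1 hi).resolve_left hΛ)
    · rintro ⟨ξ, hξ⟩ i hi
      rw [hξ i (Finset.mem_union_right _ hi), glue_of_notMem _ _ (Finset.disjoint_right.1 h hi)]
  conv_rhs => rw [pr, hU]
  rw [measureReal_biUnion_finset]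
  · rfl
  · intro ξ _ ζ _ hne
    refine Set.disjoint_left.2 fun y h1 h2 => hne ?_
    ext i
    have hi := Finset.mem_union_left T i.2
    have := (h1 i hi).symm.trans (h2 i hi)
    rwa [glue_of_mem _ _ i.2, glue_of_mem _ _ i.2] at this
  · exact fun ξ _ => measurableSet_cyl _ _

/-- The reference configuration `x₀` only fills the coordinates off `V`, which affect neither the
cylinder nor `f`. -/
theorem setIntegral_eq_sum (P : Measure (Config d A)) [IsFiniteMeasure P]
    {V : Finset (Site d)} {f : Config d A → ℝ} (hf : DependsOn f (V : Set (Site d)))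
    (x₀ : Config d A) (E : Set (Config d A)) :
    ∫ x in E, f x ∂P = ∑ ξ : V → A, P.real (cyl V (glue V ξ x₀) ∩ E) * f (glue V ξ x₀) := by
  have hV : Measurable (V.restrict : Config d A → V → A) := Finset.measurable_restrict V
  have h1 : ∀ x, f x = f (glue V (V.restrict x) x₀) := fun x => hf fun i hi => by
    rw [glue_of_mem _ _ hi]; rfl
  rw [integral_congr_ae (Eventually.of_forall h1),
    ← integral_map (f := fun ξ => f (glue V ξ x₀)) hV.aemeasurable
      (measurable_of_countable _).aestronglyMeasurable,
    integral_fintype .of_finite]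
  refine Finset.sum_congr rfl fun ξ _ => ?_
  rw [map_measureReal_apply hV (measurableSet_singleton ξ), smul_eq_mul,
    measureReal_restrict_apply (hV (measurableSet_singleton ξ)), cyl_eq_restrict, restrict_glue]
  rfl

theorem integral_eq_sum (P : Measure (Config d A)) [IsFiniteMeasure P]
    {V : Finset (Site d)} {f : Config d A → ℝ} (hf : DependsOn f (V : Set (Site d)))
    (x₀ : Config d A) :
    ∫ x, f x ∂P = ∑ ξ : V → A, pr P V (glue V ξ x₀) * f (glue V ξ x₀) := by
  rw [← setIntegral_univ, setIntegral_eq_sum P hf x₀]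
  simp [pr]

theorem integrable_of_dependsOn (P : Measure (Config d A)) [IsFiniteMeasure P]
    {V : Finset (Site d)} {f : Config d A → ℝ} (hf : DependsOn f (V : Set (Site d))) :
    Integrable f P := by
  rcases isEmpty_or_nonempty (Config d A) with hE | ⟨⟨x₀⟩⟩
  · rw [Measure.eq_zero_of_isEmpty P]
    exact integrable_zero_measure
  have h1 : f = (fun ξ => f (glue V ξ x₀)) ∘ V.restrict := funext fun x => hf fun i hi => by
    rw [glue_of_mem _ _ hi]; rfl
  rw [h1]
  exact Integrable.comp_measurable .of_finite (Finset.measurable_restrict V)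

/-- Splitting the sum lets the coordinates in `U` be summed out first, with those in `V` held fixed.
-/
theorem integral_eq_sum_sum (P : Measure (Config d A)) [IsFiniteMeasure P]
    {U V : Finset (Site d)} (hUV : Disjoint U V) {f : Config d A → ℝ}
    (hf : DependsOn f ((U ∪ V : Finset (Site d)) : Set (Site d))) (x₀ : Config d A) :
    ∫ x, f x ∂P = ∑ η : V → A, ∑ ξ : U → A,
      pr P (U ∪ V) (glue U ξ (glue V η x₀)) * f (glue U ξ (glue V η x₀)) := by
  have hsplit : ∫ x, f x ∂P = ∑ ξ : U → A, ∫ x in {x | U.restrict x = ξ}, f x ∂P := by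
    rw [← integral_iUnion_fintype]
    · rw [← setIntegral_univ]
      congr 2
      ext x
      simp
    · exact fun ξ => measurableSet_eq_fun (Finset.measurable_restrict U) measurable_const
    · intro ξ ζ hne
      exact Set.disjoint_left.2 fun x h1 h2 => hne (h1.symm.trans h2)
    · exact fun ξ => (integrable_of_dependsOn P hf).integrableOn
  rw [hsplit, Finset.sum_comm]
  refine Finset.sum_congr rfl fun ξ _ => ?_
  have h1 : ∫ x in {x | U.restrict x = ξ}, f x ∂P =
      ∫ x in {x | U.restrict x = ξ}, f (glue U ξ x) ∂P := by
    refine setIntegral_congr_fun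
      (measurableSet_eq_fun (Finset.measurable_restrict U) measurable_const) fun x hx => ?_
    have hx' : U.restrict x = ξ := hx
    simp only [← hx', glue_restrict]
  have h2 : DependsOn (fun x => f (glue U ξ x)) (V : Set (Site d)) := by
    intro x y h
    refine hf fun i hi => ?_
    by_cases hU : i ∈ U
    · rw [glue_of_mem _ _ hU, glue_of_mem _ _ hU]
    · rw [glue_of_notMem _ _ hU, glue_of_notMem _ _ hU]
      exact h i ((Finset.mem_union.1 hi).resolve_left hU)
  rw [h1, setIntegral_eq_sum P h2 x₀]
  refine Finset.sum_congr rfl fun η _ => ?_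
  congr 2
  ext y
  simp only [Set.mem_inter_iff, mem_cyl, Set.mem_ofPred_eq]
  constructor
  · rintro ⟨hV, hU⟩ i hi
    by_cases hiU : i ∈ U
    · rw [glue_of_mem _ _ hiU, ← hU]; rfl
    · rw [glue_of_notMem _ _ hiU]
      exact hV i ((Finset.mem_union.1 hi).resolve_left hiU)
  · intro hy
    refine ⟨fun i hi => ?_, ?_⟩
    · rw [hy i (Finset.mem_union_right _ hi), glue_of_notMem _ _ (Finset.disjoint_right.1 hUV hi)]
    · ext i
      exact (hy i (Finset.mem_union_left _ i.2)).trans (glue_of_mem _ _ i.2)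

theorem integrable_log_pr (P : Measure (Config d A)) [IsFiniteMeasure P]
    (V : Finset (Site d)) : Integrable (fun x => Real.log (pr P V x)) P :=
  integrable_of_dependsOn P (dependsOn_log_pr P V)

theorem entropy_eq_integral (P : Measure (Config d A)) [IsProbabilityMeasure P]
    (V : Finset (Site d)) : entropy P V = -∫ x, Real.log (pr P V x) ∂P := by
  obtain ⟨x₀⟩ := nonempty_of_isProbabilityMeasure P
  rw [integral_eq_sum P (dependsOn_log_pr P V) x₀, ← Finset.sum_neg_distrib, entropy]
  refine Finset.sum_congr rfl fun ξ _ => ?_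
  have : pr P V (glue V ξ x₀) = P.real {x | V.restrict x = ξ} := by
    rw [pr, cyl_eq_restrict, restrict_glue]
  rw [Real.negMulLog, this]
  ring

theorem condEntropy_eq_integral (P : Measure (Config d A)) [IsProbabilityMeasure P]
    (S T : Finset (Site d)) :
    condEntropy P S T = ∫ x, (Real.log (pr P T x) - Real.log (pr P (S ∪ T) x)) ∂P := by
  rw [condEntropy, entropy_eq_integral, entropy_eq_integral,
    integral_sub (integrable_log_pr P T) (integrable_log_pr P (S ∪ T))]
  ring

theorem entropy_translate {P : Measure (Config d A)} [IsProbabilityMeasure P]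
    (hP : TranslationInvariant P) (k : Site d) (V : Finset (Site d)) :
    entropy P (translate k V) = entropy P V := by
  have hm : Measurable (fun (x : Config d A) i => x (i + k)) :=
    measurable_pi_iff.2 fun i => measurable_pi_apply _
  rw [entropy_eq_integral, entropy_eq_integral]
  simp only [pr_comp_shift hP]
  have h := integral_map (μ := P) hm.aemeasurable (f := fun x => Real.log (pr P V x))
    (by rw [hP k]; exact (integrable_log_pr P V).aestronglyMeasurable)
  rw [hP k] at h
  rw [h]

theorem entropy_empty (P : Measure (Config d A)) [IsProbabilityMeasure P] :
    entropy P ∅ = 0 := by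
  simp [entropy_eq_integral, pr_empty]

/-- Conditioning on more coordinates reduces the entropy. -/
theorem condEntropy_anti {P : Measure (Config d A)} [IsProbabilityMeasure P]
    (hpos : ∀ V x, 0 < pr P V x) {S T T' : Finset (Site d)} (hT : T ⊆ T') (hS : Disjoint S T') :
    condEntropy P S T' ≤ condEntropy P S T := by
  obtain ⟨x₀⟩ := nonempty_of_isProbabilityMeasure P
  set U := T' \ T with hU
  have hUV : Disjoint U (S ∪ T) := Finset.disjoint_union_right.2
    ⟨(hS.mono_right Finset.sdiff_subset).symm, Finset.sdiff_disjoint⟩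
  have hT' : T' = U ∪ T := (Finset.sdiff_union_of_subset hT).symm
  have hST' : S ∪ T' = U ∪ (S ∪ T) := by
    rw [hT']
    ext i
    simp only [Finset.mem_union]
    tauto
  set g : Config d A → ℝ := fun x =>
    pr P (S ∪ T) x * pr P T' x / (pr P T x * pr P (S ∪ T') x) with hg
  have hdep : DependsOn g ((U ∪ (S ∪ T) : Finset (Site d)) : Set (Site d)) := by
    intro x y h
    have h' : ∀ i ∈ S ∪ T', x i = y i := fun i hi => h i (by rw [← hST']; exact hi)
    have e1 := pr_congr P h'
    have e2 := pr_congr P fun i hi => h' i (Finset.mem_union_right _ hi)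
    have e3 := pr_congr P fun i (hi : i ∈ T) => h' i (Finset.mem_union_right _ (hT hi))
    have e4 := pr_congr P fun i (hi : i ∈ S ∪ T) =>
      h' i (Finset.union_subset_union_right hT hi)
    simp only [hg, e1, e2, e3, e4]
  have hint : ∫ x, g x ∂P = 1 := by
    rw [integral_eq_sum_sum P hUV hdep x₀, ← pr_empty P x₀,
      ← sum_pr_glue P (Finset.disjoint_empty_right (S ∪ T)) x₀]
    refine Finset.sum_congr rfl fun η _ => ?_
    rw [Finset.union_empty]
    set z := glue (S ∪ T) η x₀
    have hz : ∀ ξ : U → A, ∀ i ∈ S ∪ T, glue U ξ z i = z i := fun ξ i hi =>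
      glue_of_notMem _ _ (Finset.disjoint_right.1 hUV hi)
    -- The weight cancels against the denominator of `g`; what is left depends on `ξ` only through
    -- `pr P (U ∪ T)`, which sums to `pr P T z`.
    have h1 : ∀ ξ : U → A, pr P (U ∪ (S ∪ T)) (glue U ξ z) * g (glue U ξ z) =
        pr P (S ∪ T) z / pr P T z * pr P (U ∪ T) (glue U ξ z) := by
      intro ξ
      simp only [hg]
      rw [pr_congr P (hz ξ), pr_congr P fun i hi => hz ξ i (Finset.mem_union_right _ hi),
        ← hST', ← hT']
      have := (hpos (S ∪ T') (glue U ξ z)).ne'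
      have := (hpos T z).ne'
      field_simp
    rw [Finset.sum_congr rfl fun ξ _ => h1 ξ, ← Finset.mul_sum,
      sum_pr_glue P (hUV.mono_right Finset.subset_union_right) z,
      div_mul_cancel₀ _ (hpos T z).ne']
  have hi : ∀ V W, Integrable (fun x => Real.log (pr P V x) - Real.log (pr P W x)) P :=
    fun V W => (integrable_log_pr P V).sub (integrable_log_pr P W)
  rw [condEntropy_eq_integral, condEntropy_eq_integral, ← sub_nonpos,
    ← integral_sub (hi _ _) (hi _ _)]
  have hgi := integrable_of_dependsOn P hdep
  calc _ ≤ ∫ x, (g x - 1) ∂P := by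
        refine integral_mono ((hi _ _).sub (hi _ _)) (hgi.sub (integrable_const _)) fun x => ?_
        have h1 := hpos (S ∪ T) x
        have h2 := hpos T' x
        have h3 := hpos T x
        have h4 := hpos (S ∪ T') x
        refine le_trans (le_of_eq ?_) (Real.log_le_sub_one_of_pos (show 0 < g x by positivity))
        simp only [hg]
        rw [Real.log_div (by positivity) (by positivity), Real.log_mul h1.ne' h2.ne',
          Real.log_mul h3.ne' h4.ne']
        ring
    _ = 0 := by
      rw [integral_sub hgi (integrable_const _), hint]
      simp

theorem condEntropy_nonneg {P : Measure (Config d A)} [IsProbabilityMeasure P]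
    (hpos : ∀ V x, 0 < pr P V x) (S T : Finset (Site d)) : 0 ≤ condEntropy P S T := by
  rw [condEntropy_eq_integral]
  refine integral_nonneg fun x => sub_nonneg.2 ?_
  exact Real.log_le_log (hpos _ _) (pr_anti P Finset.subset_union_right x)

end Cylinder

/-! ### Averages over van Hove volumes. -/

section VanHove

variable {d : ℕ}

@[simp]
theorem mem_translate {k i : Site d} {V : Finset (Site d)} : i ∈ translate k V ↔ i - k ∈ V := by
  simp [translate, sub_eq_add_neg, add_comm i]

theorem tendsto_card_symmDiff_div (k : Site d) :
    Tendsto (fun V : Finset (Site d) => ((symmDiff (translate k V) V).card : ℝ) / V.card)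
      (vanHove d) (𝓝 0) :=
  tendsto_comap.mono_left (inf_le_right.trans (iInf_le _ k))

theorem eventually_nonempty_vanHove : ∀ᶠ V in vanHove d, V.Nonempty :=
  mem_inf_of_left (mem_principal_self _)

/-- Averages over van Hove volumes of a bounded function of the volume as seen from its sites
converge to the limit of the function along all finite volumes. -/
theorem tendsto_average_vanHove {g : Finset (Site d) → ℝ} {h C : ℝ} (hC : ∀ U, |g U| ≤ C)
    (hg : Tendsto g atTop (𝓝 h)) :
    Tendsto (fun V => (∑ k ∈ V, g (translate (-k) V)) / V.card) (vanHove d) (𝓝 h) := by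
  rw [Metric.tendsto_nhds]
  intro ε hε
  -- `W` is a window beyond which `g` is within `ε / 2` of `h`. A site `k` is bad if `k + w ∉ V` for
  -- some `w ∈ W`; bad sites cost at most `C + |h|` each and are counted by the symmetric
  -- differences.
  obtain ⟨W, hW⟩ := eventually_atTop.1 ((Metric.tendsto_nhds.1 hg) (ε / 2) (half_pos hε))
  have hlim : Tendsto (fun V : Finset (Site d) => ε / 2 +
      ∑ w ∈ W, (C + |h|) * (((symmDiff (translate (-w) V) V).card : ℝ) / V.card)) (vanHove d)
      (𝓝 (ε / 2 + ∑ w ∈ W, (C + |h|) * 0)) :=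
    (tendsto_finsetSum W fun w _ => (tendsto_card_symmDiff_div (-w)).const_mul _).const_add _
  have hlt : ε / 2 + ∑ w ∈ W, (C + |h|) * 0 < ε := by simpa using half_lt_self hε
  filter_upwards [hlim.eventually_lt_const hlt, eventually_nonempty_vanHove] with V hV hne
  refine lt_of_le_of_lt ?_ hV
  have hcard : (0 : ℝ) < V.card := Nat.cast_pos.2 hne.card_pos
  have hD : ∀ U, |g U - h| ≤ C + |h| := fun U => (abs_sub _ _).trans (by gcongr; exact hC U)
  have hD0 : 0 ≤ C + |h| := (abs_nonneg _).trans (hD ∅)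
  have hterm : ∀ k ∈ V, |g (translate (-k) V) - h| ≤
      ε / 2 + ∑ w ∈ W, (C + |h|) * (if k + w ∈ V then 0 else 1) := by
    intro k _
    by_cases hk : ∀ w ∈ W, k + w ∈ V
    · have h1 := hW (translate (-k) V) fun w hw => by
        rw [mem_translate, sub_neg_eq_add, add_comm]
        exact hk w hw
      rw [Real.dist_eq] at h1
      have : 0 ≤ ∑ w ∈ W, (C + |h|) * (if k + w ∈ V then (0 : ℝ) else 1) :=
        Finset.sum_nonneg fun w _ => mul_nonneg hD0 (by split_ifs <;> norm_num)
      linarith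
    · push Not at hk
      obtain ⟨w, hw, hkw⟩ := hk
      have h1 := Finset.single_le_sum
        (f := fun w => (C + |h|) * (if k + w ∈ V then (0 : ℝ) else 1))
        (fun w _ => mul_nonneg hD0 (by split_ifs <;> norm_num)) hw
      simp only [if_neg hkw, mul_one] at h1
      linarith [hD (translate (-k) V)]
  have hcount : ∀ w, ∑ k ∈ V, (if k + w ∈ V then (0 : ℝ) else 1) ≤
      (symmDiff (translate (-w) V) V).card := by
    intro w
    have h1 : ∑ k ∈ V, (if k + w ∈ V then (0 : ℝ) else 1) =
        (V.filter fun k => k + w ∉ V).card := by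
      rw [Finset.card_filter, Nat.cast_sum]
      refine Finset.sum_congr rfl fun k _ => ?_
      by_cases hk : k + w ∈ V <;> simp [hk]
    rw [h1]
    refine Nat.cast_le.2 (Finset.card_le_card fun k hk => ?_)
    rw [Finset.mem_filter] at hk
    rw [Finset.mem_symmDiff, mem_translate, sub_neg_eq_add]
    exact Or.inr hk
  rw [Real.dist_eq, show (∑ k ∈ V, g (translate (-k) V)) / V.card - h =
    (∑ k ∈ V, (g (translate (-k) V) - h)) / V.card by
      rw [Finset.sum_sub_distrib, Finset.sum_const, nsmul_eq_mul]; field_simp,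
    abs_div, abs_of_pos hcard, div_le_iff₀ hcard]
  calc |∑ k ∈ V, (g (translate (-k) V) - h)| ≤ ∑ k ∈ V, |g (translate (-k) V) - h| :=
        Finset.abs_sum_le_sum_abs _ _
    _ ≤ ∑ k ∈ V, (ε / 2 + ∑ w ∈ W, (C + |h|) * (if k + w ∈ V then 0 else 1)) :=
        Finset.sum_le_sum hterm
    _ = V.card * (ε / 2) +
        ∑ w ∈ W, (C + |h|) * ∑ k ∈ V, (if k + w ∈ V then (0 : ℝ) else 1) := by
        rw [Finset.sum_add_distrib, Finset.sum_const, nsmul_eq_mul, Finset.sum_comm]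
        simp only [Finset.mul_sum]
    _ ≤ V.card * (ε / 2) +
        ∑ w ∈ W, (C + |h|) * ((symmDiff (translate (-w) V) V).card : ℝ) := by
        gcongr with w _
        exact hcount w
    _ = _ := by
        rw [add_mul, Finset.sum_mul, mul_comm (V.card : ℝ)]
        congr 1
        refine Finset.sum_congr rfl fun w _ => ?_
        field_simp

/-- The sites of `V` that precede `k` in the lexicographic order. -/
noncomputable def preceding (k : Site d) (V : Finset (Site d)) : Finset (Site d) :=
  open Classical in V.filter fun j => toLex j < toLex k

theorem mem_preceding {k j : Site d} {V : Finset (Site d)} :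
    j ∈ preceding k V ↔ j ∈ V ∧ toLex j < toLex k := by
  simp [preceding]

end VanHove

/-! ### Existence of the entropy density. -/

section Density

variable {d : ℕ} {A : Type*} [Fintype A] [MeasurableSpace A] [MeasurableSingletonClass A]
  {P : Measure (Config d A)} [IsProbabilityMeasure P]

theorem condEntropy_translate (hP : TranslationInvariant P) (k : Site d)
    (S T : Finset (Site d)) :
    condEntropy P (translate k S) (translate k T) = condEntropy P S T := by
  rw [condEntropy, condEntropy, entropy_translate hP, translate, translate, ← Finset.image_union,
    ← translate, entropy_translate hP]

theorem condEntropy_empty_right (S : Finset (Site d)) : condEntropy P S ∅ = entropy P S := by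
  rw [condEntropy, entropy_empty, sub_zero, Finset.union_empty]

theorem abs_condEntropy_le (hpos : ∀ V x, 0 < pr P V x) {S T : Finset (Site d)}
    (hS : Disjoint S T) : |condEntropy P S T| ≤ entropy P S := by
  rw [abs_of_nonneg (condEntropy_nonneg hpos S T), ← condEntropy_empty_right]
  exact condEntropy_anti hpos (Finset.empty_subset T) hS

theorem entropy_nonneg (hpos : ∀ V x, 0 < pr P V x) (V : Finset (Site d)) : 0 ≤ entropy P V := by
  rw [← condEntropy_empty_right]
  exact condEntropy_nonneg hpos V ∅

/-- The chain rule for the entropy along the lexicographic order. -/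
theorem entropy_eq_sum_condEntropy (V : Finset (Site d)) :
    entropy P V = ∑ k ∈ V, condEntropy P {k} (preceding k V) := by
  -- Sites are added in increasing order, so the new site is preceded by all the old ones and the
  -- old sites keep their predecessors.
  induction V using Finset.induction_on_max_value (f := fun k : Site d => toLex k) with
  | empty => simp [entropy_empty]
  | insert a s ha hmax ih =>
    have hlt : ∀ x ∈ s, toLex x < toLex a := fun x hx =>
      lt_of_le_of_ne (hmax x hx) fun h => ha (by rwa [← toLex_inj.1 h])
    have h1 : preceding a (insert a s) = s := by
      ext j
      rw [mem_preceding, Finset.mem_insert]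
      exact ⟨fun h => h.1.resolve_left fun e => h.2.ne (by rw [e]), fun h => ⟨.inr h, hlt j h⟩⟩
    have h2 : ∀ k ∈ s, preceding k (insert a s) = preceding k s := fun k hk => by
      ext j
      rw [mem_preceding, mem_preceding, Finset.mem_insert]
      exact ⟨fun h => ⟨h.1.resolve_left fun e => (hlt k hk).not_gt (by rw [← e]; exact h.2), h.2⟩,
        fun h => ⟨.inr h.1, h.2⟩⟩
    rw [Finset.sum_insert ha, h1, Finset.sum_congr rfl fun k hk => by rw [h2 k hk], ← ih,
      condEntropy, ← Finset.insert_eq]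
    ring

theorem exists_tendsto_entropy_div_card (hpos : ∀ V x, 0 < pr P V x)
    (hP : TranslationInvariant P) :
    ∃ h, Tendsto (fun V => entropy P V / V.card) (vanHove d) (𝓝 h) := by
  have hdisj : ∀ U : Finset (Site d), Disjoint ({0} : Finset (Site d)) (preceding 0 U) := by
    exact fun U => Finset.disjoint_singleton_left.2 fun h => lt_irrefl _ (mem_preceding.1 h).2
  have hanti : Antitone fun U : Finset (Site d) => condEntropy P {0} (preceding 0 U) :=
    fun U V h => condEntropy_anti hpos
      (fun j hj => mem_preceding.2 ⟨h (mem_preceding.1 hj).1, (mem_preceding.1 hj).2⟩) (hdisj V)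
  have hlim := tendsto_atTop_ciInf hanti
    ⟨0, Set.forall_mem_range.2 fun U => condEntropy_nonneg hpos _ _⟩
  refine ⟨_, (tendsto_average_vanHove (fun U => abs_condEntropy_le hpos (hdisj U)) hlim).congr
    fun V => ?_⟩
  rw [entropy_eq_sum_condEntropy]
  congr 1
  refine Finset.sum_congr rfl fun k _ => ?_
  rw [← condEntropy_translate hP k]
  congr 1
  · ext i
    simp [sub_eq_zero]
  · ext i
    -- The lexicographic order is translation invariant, so the past of `k` in `V` is the translate
    -- of the past of `0` in `V - k`.
    have : toLex (i - k) < toLex 0 ↔ toLex i < toLex k := by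
      rw [toLex_sub, toLex_zero, sub_neg]
    rw [mem_translate, mem_preceding, mem_preceding, mem_translate, sub_neg_eq_add,
      sub_add_cancel, this]

theorem meanErasureEntropy_eq (hP : TranslationInvariant P) (Λ V : Finset (Site d)) :
    meanErasureEntropy P Λ V =
      (∑ k ∈ V, condEntropy P (Λ ∩ translate (-k) V) (translate (-k) V \ Λ)) / V.card := by
  rw [meanErasureEntropy]
  congr 1
  refine Finset.sum_congr rfl fun k _ => ?_
  rw [← condEntropy_translate hP k (Λ ∩ _)]
  congr 1 <;>
  · ext i
    simp

end Density

/-! ### DLR equations and the formula for the erasure entropy rate. -/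

section Gibbs

variable {d : ℕ} {A : Type*} [Fintype A] [MeasurableSpace A] [MeasurableSingletonClass A]
  {Φ : Interaction d A} {P : Measure (Config d A)}

theorem integrable_gibbsSpec (Φ : Interaction d A) (Λ : Finset (Site d)) (ξ : Λ → A)
    (P : Measure (Config d A)) [IsFiniteMeasure P] : Integrable (gibbsSpec Φ Λ ξ) P := by
  refine Integrable.of_bound
    ((measurable_gibbsSpec Φ Λ ξ).mono cylinderEvents_le_pi le_rfl).aestronglyMeasurable 1
    (Eventually.of_forall fun x => ?_)
  rw [Real.norm_of_nonneg (gibbsSpec_pos ..).le]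
  exact gibbsSpec_le_one ..

theorem measurableSet_restrict_eq (Λ : Finset (Site d)) (ξ : Λ → A) :
    MeasurableSet {x : Config d A | Λ.restrict x = ξ} :=
  measurableSet_eq_fun (Finset.measurable_restrict Λ) measurable_const

theorem IsGibbs.setIntegral_gibbsSpec (hP : IsGibbs Φ P) (Λ : Finset (Site d)) (ξ : Λ → A)
    {s : Set (Config d A)} (hs : MeasurableSet[cylinderEvents ((Λ : Set (Site d))ᶜ)] s) :
    ∫ x in s, gibbsSpec Φ Λ ξ x ∂P = P.real ({x | Λ.restrict x = ξ} ∩ s) := by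
  have := hP.isProbabilityMeasure
  have hm := measurableSet_restrict_eq Λ ξ
  rw [← integral_congr_ae (ae_restrict_of_ae (hP.dlr Λ ξ)), setIntegral_condExp
    cylinderEvents_le_pi ((integrable_const (1 : ℝ)).indicator hm) hs, integral_indicator hm,
    setIntegral_const, measureReal_restrict_apply hm]
  simp

theorem IsGibbs.pr_union (hP : IsGibbs Φ P) {Λ T : Finset (Site d)} (h : Disjoint Λ T)
    (x : Config d A) :
    pr P (Λ ∪ T) x = ∫ y in cyl T x, gibbsSpec Φ Λ (Λ.restrict x) y ∂P := by
  rw [hP.setIntegral_gibbsSpec Λ _ (measurableSet_cyl' (fun i hi => by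
    simpa using Finset.disjoint_right.1 h hi) x), ← cyl_eq_restrict, pr]
  congr 1
  ext y
  simp only [mem_cyl, Finset.mem_union, Set.mem_inter_iff, or_imp, forall_and]

theorem IsGibbs.pr_union_le (hP : IsGibbs Φ P) (hΦ : AbsolutelySummable Φ)
    {Λ T : Finset (Site d)} (h : Disjoint Λ T) (x : Config d A) :
    pr P (Λ ∪ T) x ≤ Real.exp (4 * tail Φ Λ (Λ ∪ T)) * gibbsDensity Φ Λ x * pr P T x := by
  have := hP.isProbabilityMeasure
  rw [hP.pr_union h]
  refine (setIntegral_mono_on (integrable_gibbsSpec Φ Λ _ P).integrableOn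
    (integrable_const _).integrableOn (measurableSet_cyl T x)
    fun y hy => gibbsSpec_le hΦ Λ T _ hy).trans (le_of_eq ?_)
  rw [setIntegral_const, smul_eq_mul, mul_comm, pr, gibbsDensity]

theorem IsGibbs.le_pr_union (hP : IsGibbs Φ P) (hΦ : AbsolutelySummable Φ)
    {Λ T : Finset (Site d)} (h : Disjoint Λ T) (x : Config d A) :
    gibbsDensity Φ Λ x * pr P T x ≤ Real.exp (4 * tail Φ Λ (Λ ∪ T)) * pr P (Λ ∪ T) x := by
  have := hP.isProbabilityMeasure
  rw [hP.pr_union h, ← integral_const_mul]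
  refine le_trans (le_of_eq ?_) (setIntegral_mono_on (f := fun _ => gibbsDensity Φ Λ x)
    (integrable_const _).integrableOn
    ((integrable_gibbsSpec Φ Λ _ P).const_mul _).integrableOn (measurableSet_cyl T x)
    fun y hy => gibbsSpec_le hΦ Λ T _ fun i hi => (hy i hi).symm)
  rw [setIntegral_const, smul_eq_mul, mul_comm, pr]

/-- With `T = ∅`, the lower DLR bound compares the cylinder probability with `gibbsDensity`, which
is positive. -/
theorem IsGibbs.pr_pos (hP : IsGibbs Φ P) (hΦ : AbsolutelySummable Φ) (V : Finset (Site d))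
    (x : Config d A) : 0 < pr P V x := by
  have := hP.isProbabilityMeasure
  have h := hP.le_pr_union hΦ (Finset.disjoint_empty_right V) x
  rw [pr_empty, mul_one, Finset.union_empty] at h
  exact pos_of_mul_pos_right ((gibbsDensity_pos Φ V x).trans_le h) (Real.exp_pos _).le

theorem IsGibbs.abs_log_pr_union_sub_le (hP : IsGibbs Φ P) (hΦ : AbsolutelySummable Φ)
    {Λ T : Finset (Site d)} (h : Disjoint Λ T) (x : Config d A) :
    |Real.log (pr P (Λ ∪ T) x) - Real.log (pr P T x) - Real.log (gibbsDensity Φ Λ x)| ≤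
      4 * tail Φ Λ (Λ ∪ T) := by
  have h1 := hP.pr_pos hΦ (Λ ∪ T) x
  have h2 := hP.pr_pos hΦ T x
  have h3 := gibbsDensity_pos Φ Λ x
  have h4 := Real.exp_pos (4 * tail Φ Λ (Λ ∪ T))
  have h5 := Real.log_le_log h1 (hP.pr_union_le hΦ h x)
  have h6 := Real.log_le_log (mul_pos h3 h2) (hP.le_pr_union hΦ h x)
  rw [Real.log_mul (by positivity) h2.ne', Real.log_mul h4.ne' h3.ne', Real.log_exp] at h5
  rw [Real.log_mul h3.ne' h2.ne', Real.log_mul h4.ne' h1.ne', Real.log_exp] at h6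
  exact abs_le.2 ⟨by linarith, by linarith⟩

/-- With `T = ∅`, the integrand stays within a constant of `log (pr P Λ x)`, which depends on
finitely many coordinates. -/
theorem IsGibbs.integrable_log_gibbsDensity (hP : IsGibbs Φ P) (hΦ : AbsolutelySummable Φ)
    (Λ : Finset (Site d)) : Integrable (fun x => Real.log (gibbsDensity Φ Λ x)) P := by
  have := hP.isProbabilityMeasure
  refine Integrable.mono' ((integrable_log_pr P Λ).norm.add
    (integrable_const (4 * tail Φ Λ Λ)))
    (measurable_gibbsDensity Φ Λ).log.aestronglyMeasurable (Eventually.of_forall fun x => ?_)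
  have h := hP.abs_log_pr_union_sub_le hΦ (Finset.disjoint_empty_right Λ) x
  rw [pr_empty, Real.log_one, sub_zero, Finset.union_empty] at h
  simp only [Pi.add_apply]
  rw [Real.norm_eq_abs, Real.norm_eq_abs]
  have := abs_sub_abs_le_abs_sub (Real.log (gibbsDensity Φ Λ x)) (Real.log (pr P Λ x))
  rw [abs_sub_comm] at this
  linarith

theorem IsGibbs.abs_condEntropy_add_integral_le (hP : IsGibbs Φ P) (hΦ : AbsolutelySummable Φ)
    {Λ T : Finset (Site d)} (h : Disjoint Λ T) :
    |condEntropy P Λ T + ∫ x, Real.log (gibbsDensity Φ Λ x) ∂P| ≤ 4 * tail Φ Λ (Λ ∪ T) := by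
  have := hP.isProbabilityMeasure
  have hi : Integrable (fun x => Real.log (pr P T x) - Real.log (pr P (Λ ∪ T) x)) P :=
    (integrable_log_pr P T).sub (integrable_log_pr P (Λ ∪ T))
  rw [condEntropy_eq_integral, ← integral_add hi (hP.integrable_log_gibbsDensity hΦ Λ), ← Real.norm_eq_abs]
  refine (norm_integral_le_of_norm_le_const (C := 4 * tail Φ Λ (Λ ∪ T))
    (Eventually.of_forall fun x => ?_)).trans (by simp)
  rw [Real.norm_eq_abs, ← abs_neg]
  refine le_trans (le_of_eq (congrArg abs ?_)) (hP.abs_log_pr_union_sub_le hΦ h x)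
  ring

theorem IsGibbs.tendsto_condEntropy (hP : IsGibbs Φ P) (hΦ : AbsolutelySummable Φ)
    (Λ : Finset (Site d)) :
    Tendsto (fun U => condEntropy P (Λ ∩ U) (U \ Λ)) atTop
      (𝓝 (-∫ x, Real.log (gibbsDensity Φ Λ x) ∂P)) := by
  rw [tendsto_iff_dist_tendsto_zero]
  have hlim := (tendsto_tail hΦ Λ).const_mul 4
  rw [mul_zero] at hlim
  refine squeeze_zero' (Eventually.of_forall fun _ => dist_nonneg) ?_ hlim
  filter_upwards [eventually_ge_atTop Λ] with U hU
  rw [Real.dist_eq, sub_neg_eq_add, Finset.inter_eq_left.2 hU]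
  refine (hP.abs_condEntropy_add_integral_le hΦ Finset.disjoint_sdiff).trans (le_of_eq ?_)
  rw [Finset.union_sdiff_of_subset hU]

theorem IsGibbs.tendsto_meanErasureEntropy (hP : IsGibbs Φ P) (hΦ : AbsolutelySummable Φ)
    (hT : TranslationInvariant P) (Λ : Finset (Site d)) :
    Tendsto (meanErasureEntropy P Λ) (vanHove d)
      (𝓝 (-∫ x, Real.log (gibbsDensity Φ Λ x) ∂P)) := by
  have := hP.isProbabilityMeasure
  have hpos := hP.pr_pos hΦ
  -- The set `Λ ∩ U` varies with `U`; summing over all subsets of `Λ` is a crude bound uniform in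
  -- `U`.
  have hC : ∀ U, |condEntropy P (Λ ∩ U) (U \ Λ)| ≤ ∑ S ∈ Λ.powerset, entropy P S := fun U =>
    (abs_condEntropy_le hpos (Finset.disjoint_sdiff.mono_left Finset.inter_subset_left)).trans
      (Finset.single_le_sum (fun S _ => entropy_nonneg hpos S)
        (Finset.mem_powerset.2 Finset.inter_subset_left))
  exact (tendsto_average_vanHove hC (hP.tendsto_condEntropy hΦ Λ)).congr fun V =>
    (meanErasureEntropy_eq hT Λ V).symm

theorem IsGibbs.erasureEntropyRate_eq (hP : IsGibbs Φ P) (hΦ : AbsolutelySummable Φ)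
    (hT : TranslationInvariant P) (Λ : Finset (Site d)) :
    erasureEntropyRate P Λ = -∫ x, Real.log (gibbsDensity Φ Λ x) ∂P :=
  -- Uniqueness of the limit needs `vanHove d` to be nontrivial, which the cubes provide.
  (hP.tendsto_meanErasureEntropy hΦ hT Λ).limUnder_eq

end Gibbs

/-! ### The boundary term is of smaller order than the volume. -/

section BoundaryEnergy

variable {d : ℕ} {A : Type*} [Fintype A] {Φ : Interaction d A}

/-- A bound on the dependence of a finite volume on its exterior, given by the influence on the
single sites. -/
noncomputable def boundaryEnergy (Φ : Interaction d A) (Λ : Finset (Site d)) : ℝ :=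
  ∑ i ∈ Λ, 24 * tail Φ {0} (translate (-i) Λ)

theorem tendsto_boundaryEnergy_div_card (hΦ : AbsolutelySummable Φ) :
    Tendsto (fun Λ => boundaryEnergy Φ Λ / Λ.card) (vanHove d) (𝓝 0) := by
  have h := (tendsto_tail hΦ {0}).const_mul 24
  rw [mul_zero] at h
  refine (tendsto_average_vanHove (g := fun U => 24 * tail Φ {0} U) (C := 24 * tail Φ {0} ∅)
    (fun U => ?_) h).congr fun Λ => by rw [boundaryEnergy]
  rw [abs_of_nonneg (mul_nonneg (by norm_num) (tail_nonneg _ _ _))]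
  have := tail_antitone hΦ {0} (Finset.empty_subset U)
  linarith

end BoundaryEnergy

/-! ### A finite volume is nearly independent of its exterior. -/

section BoundaryEffect

variable {d : ℕ} {A : Type*} [Fintype A] [MeasurableSpace A] [MeasurableSingletonClass A]
  {Φ : Interaction d A} {P : Measure (Config d A)}

/-- `Φ` itself need not be shift invariant; the invariance of `P` moves the site `i` to the origin.
The constant is `12 = 4 + 4 + 4`: conditional probability against `γ` at `x` and at `y`, and `γ` at
`x` against `γ` at `y`. -/
theorem IsGibbs.abs_log_pr_erase_sub_le (hP : IsGibbs Φ P) (hΦ : AbsolutelySummable Φ)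
    (hT : TranslationInvariant P) {Λ V : Finset (Site d)} (hV : Λ ⊆ V) {i : Site d} (hi : i ∈ Λ)
    {x y : Config d A} (hxy : ∀ j ∈ Λ, x j = y j) :
    |(Real.log (pr P V x) - Real.log (pr P (V.erase i) x)) -
      (Real.log (pr P V y) - Real.log (pr P (V.erase i) y))| ≤
      12 * tail Φ {0} (translate (-i) Λ) := by
  set T := (translate (-i) V).erase 0 with hTdef
  have hd : Disjoint ({0} : Finset (Site d)) T := by simp [hTdef]
  have h0 : ∀ {W : Finset (Site d)}, i ∈ W → {0} ∪ (translate (-i) W).erase 0 =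
      translate (-i) W := fun h => by
    rw [← Finset.insert_eq, Finset.insert_erase (by simpa using h)]
  have hV0 := h0 (hV hi)
  have e1 : V = translate i ({0} ∪ T) := by
    rw [hV0]
    ext j
    simp
  have e2 : V.erase i = translate i T := by
    ext j
    simp [hTdef, sub_eq_zero]
  have hsub : translate (-i) Λ ⊆ {0} ∪ T := by
    rw [hV0]
    exact Finset.image_subset_image hV
  have key : ∀ z : Config d A, |Real.log (pr P V z) - Real.log (pr P (V.erase i) z) -
      Real.log (gibbsDensity Φ {0} fun j => z (j + i))| ≤ 4 * tail Φ {0} (translate (-i) Λ) := by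
    intro z
    rw [e2, e1, pr_comp_shift hT, pr_comp_shift hT]
    refine (hP.abs_log_pr_union_sub_le hΦ hd _).trans ?_
    gcongr
    exact tail_antitone hΦ {0} hsub
  have hγ : |Real.log (gibbsDensity Φ {0} fun j => x (j + i)) -
      Real.log (gibbsDensity Φ {0} fun j => y (j + i))| ≤
      4 * tail Φ {0} (translate (-i) Λ) := by
    have h := abs_log_gibbsDensity_sub_le hΦ {0} ((translate (-i) Λ).erase 0)
      (x := fun j => x (j + i)) (y := fun j => y (j + i)) fun j hj => by
        rw [h0 hi, mem_translate, sub_neg_eq_add] at hj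
        exact hxy _ hj
    rwa [h0 hi] at h
  have hx := abs_le.1 (key x)
  have hy := abs_le.1 (key y)
  have hg := abs_le.1 hγ
  exact abs_le.2 ⟨by linarith, by linarith⟩

/-- The sites of `F` are replaced one at a time, and each replacement uses the single-site estimate
twice, before and after, whence `24 = 2 * 12`. -/
theorem IsGibbs.abs_log_pr_piecewise_sub_le (hP : IsGibbs Φ P) (hΦ : AbsolutelySummable Φ)
    (hT : TranslationInvariant P) {Λ V : Finset (Site d)} (hV : Λ ⊆ V)
    {x y : Config d A} (hxy : ∀ j ∈ Λ, x j = y j) (z : Config d A) {F : Finset (Site d)}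
    (hF : F ⊆ Λ) :
    |(Real.log (pr P V x) - Real.log (pr P V (F.piecewise z x))) -
      (Real.log (pr P V y) - Real.log (pr P V (F.piecewise z y)))| ≤
      ∑ i ∈ F, 24 * tail Φ {0} (translate (-i) Λ) := by
  induction F using Finset.induction_on with
  | empty => simp
  | insert i F hi ih =>
    have ih' := ih ((Finset.subset_insert i F).trans hF)
    have hiΛ : i ∈ Λ := hF (Finset.mem_insert_self i F)
    rw [Finset.sum_insert hi, Finset.piecewise_insert, Finset.piecewise_insert]
    set w := F.piecewise z x with hw
    set w' := F.piecewise z y with hw'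
    have hww : ∀ j ∈ Λ, w j = w' j := fun j hj => by
      by_cases h : j ∈ F
      · simp [hw, hw', h]
      · simp [hw, hw', h, hxy j hj]
    have h1 := hP.abs_log_pr_erase_sub_le hΦ hT hV hiΛ hww
    have h2 := hP.abs_log_pr_erase_sub_le hΦ hT hV hiΛ (x := Function.update w i (z i))
      (y := Function.update w' i (z i)) fun j hj => by
        by_cases h : j = i
        · subst h; simp
        · simp [h, hww j hj]
    -- The volume without `i` does not see the update, so these terms cancel between the two
    -- estimates.
    have he : ∀ u : Config d A,
        pr P (V.erase i) (Function.update u i (z i)) = pr P (V.erase i) u := fun u =>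
      pr_congr P fun j hj => Function.update_of_ne (Finset.ne_of_mem_erase hj) _ _
    rw [he, he] at h2
    have h1' := abs_le.1 h1
    have h2' := abs_le.1 h2
    have ih'' := abs_le.1 ih'
    exact abs_le.2 ⟨by linarith, by linarith⟩

/-- Exchanging the parts of two configurations on `Λ` changes the product of their probabilities by
at most a factor `exp (boundaryEnergy Φ Λ)`. Summing `hcross` over the second configuration `(ζ, η)`
turns one side into `pr P V x` and the other into the product of the marginals. -/
theorem IsGibbs.log_pr_union_le (hP : IsGibbs Φ P) (hΦ : AbsolutelySummable Φ)
    (hT : TranslationInvariant P) {Λ T : Finset (Site d)} (h : Disjoint Λ T) (x : Config d A) :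
    Real.log (pr P (Λ ∪ T) x) ≤
      boundaryEnergy Φ Λ + Real.log (pr P Λ x) + Real.log (pr P T x) := by
  have := hP.isProbabilityMeasure
  have hpos := hP.pr_pos hΦ
  set V := Λ ∪ T with hV
  have hpw : ∀ (ζ : Λ → A) (u : Config d A), Λ.piecewise (glue Λ ζ x) u = glue Λ ζ u := by
    intro ζ u
    ext j
    by_cases hj : j ∈ Λ
    · rw [Finset.piecewise_eq_of_mem _ _ _ hj, glue_of_mem _ _ hj, glue_of_mem _ _ hj]
    · rw [Finset.piecewise_eq_of_notMem _ _ _ hj, glue_of_notMem _ _ hj]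
  have hcross : ∀ (η : T → A) (ζ : Λ → A), pr P V x * pr P V (glue Λ ζ (glue T η x)) ≤
      Real.exp (boundaryEnergy Φ Λ) * (pr P V (glue T η x) * pr P V (glue Λ ζ x)) := by
    intro η ζ
    have h1 := hP.abs_log_pr_piecewise_sub_le hΦ hT (V := V) Finset.subset_union_left
      (x := x) (y := glue T η x)
      (fun j hj => (glue_of_notMem _ _ (Finset.disjoint_left.1 h hj)).symm) (glue Λ ζ x)
      subset_rfl
    rw [hpw, hpw] at h1
    have h2 := (abs_le.1 h1).2
    have p1 := hpos V x
    have p2 := hpos V (glue Λ ζ (glue T η x))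
    have p3 := hpos V (glue T η x)
    have p4 := hpos V (glue Λ ζ x)
    rw [← Real.log_le_log_iff (by positivity) (by positivity), Real.log_mul p1.ne' p2.ne',
      Real.log_mul (Real.exp_pos _).ne' (by positivity), Real.log_mul p3.ne' p4.ne', Real.log_exp,
      boundaryEnergy]
    linarith
  have hT1 : ∑ η : T → A, pr P T (glue T η x) = 1 := by
    have := sum_pr_glue P (Finset.disjoint_empty_right T) x
    rwa [Finset.union_empty, pr_empty] at this
  have hΛ1 : ∑ η : T → A, pr P V (glue T η x) = pr P Λ x := by
    rw [hV, Finset.union_comm]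
    exact sum_pr_glue P h.symm x
  have hsum := Finset.sum_le_sum fun η (_ : η ∈ (Finset.univ : Finset (T → A))) =>
    Finset.sum_le_sum fun ζ (_ : ζ ∈ (Finset.univ : Finset (Λ → A))) => hcross η ζ
  simp only [← Finset.mul_sum] at hsum
  simp only [hV, sum_pr_glue P h] at hsum
  rw [hT1, mul_one, ← Finset.sum_mul, ← hV, hΛ1] at hsum
  have p1 := hpos Λ x
  have p2 := hpos T x
  have h3 := Real.log_le_log (hpos V x) hsum
  rw [Real.log_mul (Real.exp_pos _).ne' (by positivity), Real.log_mul p1.ne' p2.ne',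
    Real.log_exp] at h3
  linarith

theorem IsGibbs.entropy_sub_le_condEntropy (hP : IsGibbs Φ P) (hΦ : AbsolutelySummable Φ)
    (hT : TranslationInvariant P) {Λ T : Finset (Site d)} (h : Disjoint Λ T) :
    entropy P Λ - boundaryEnergy Φ Λ ≤ condEntropy P Λ T := by
  have := hP.isProbabilityMeasure
  rw [condEntropy, entropy_eq_integral, entropy_eq_integral, entropy_eq_integral]
  have hi : Integrable (fun x => boundaryEnergy Φ Λ + Real.log (pr P Λ x)) P :=
    (integrable_const _).add (integrable_log_pr P Λ)
  have h1 := integral_mono (integrable_log_pr P (Λ ∪ T)) (hi.add (integrable_log_pr P T))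
    fun x => hP.log_pr_union_le hΦ hT h x
  simp only [Pi.add_apply] at h1
  rw [integral_add hi (integrable_log_pr P T), integral_add (integrable_const _)
    (integrable_log_pr P Λ), integral_const, probReal_univ, one_smul] at h1
  linarith

theorem IsGibbs.erasureEntropyRate_le (hP : IsGibbs Φ P) (hΦ : AbsolutelySummable Φ)
    (hT : TranslationInvariant P) (Λ : Finset (Site d)) :
    erasureEntropyRate P Λ ≤ entropy P Λ := by
  have := hP.isProbabilityMeasure
  rw [hP.erasureEntropyRate_eq hΦ hT]
  -- The rate is also the limit of `H(X_Λ | X_{U \ Λ})`, so a bound uniform in `U` suffices.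
  refine le_of_tendsto (hP.tendsto_condEntropy hΦ Λ) ?_
  filter_upwards [eventually_ge_atTop Λ] with U hU
  rw [Finset.inter_eq_left.2 hU]
  exact (le_abs_self _).trans (abs_condEntropy_le (hP.pr_pos hΦ) Finset.disjoint_sdiff)

theorem IsGibbs.entropy_sub_le_erasureEntropyRate (hP : IsGibbs Φ P)
    (hΦ : AbsolutelySummable Φ) (hT : TranslationInvariant P) (Λ : Finset (Site d)) :
    entropy P Λ - boundaryEnergy Φ Λ ≤ erasureEntropyRate P Λ := by
  rw [hP.erasureEntropyRate_eq hΦ hT]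
  refine ge_of_tendsto (hP.tendsto_condEntropy hΦ Λ) ?_
  filter_upwards [eventually_ge_atTop Λ] with U hU
  rw [Finset.inter_eq_left.2 hU]
  exact hP.entropy_sub_le_condEntropy hΦ hT Finset.disjoint_sdiff

theorem IsGibbs.tendsto_entropy_div_card (hP : IsGibbs Φ P) (hΦ : AbsolutelySummable Φ)
    (hT : TranslationInvariant P) :
    Tendsto (fun V => entropy P V / V.card) (vanHove d) (𝓝 (entropyDensity P)) := by
  have := hP.isProbabilityMeasure
  exact tendsto_nhds_limUnder (exists_tendsto_entropy_div_card (hP.pr_pos hΦ) hT)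

theorem IsGibbs.tendsto_erasureEntropyRate_div_card (hP : IsGibbs Φ P)
    (hΦ : AbsolutelySummable Φ) (hT : TranslationInvariant P) :
    Tendsto (fun Λ => erasureEntropyRate P Λ / Λ.card) (vanHove d) (𝓝 (entropyDensity P)) := by
  have h := hP.tendsto_entropy_div_card hΦ hT
  have h' := h.sub (tendsto_boundaryEnergy_div_card hΦ)
  rw [sub_zero] at h'
  refine tendsto_of_tendsto_of_tendsto_of_le_of_le h' h (fun Λ => ?_) fun Λ => ?_
  · rw [← sub_div]
    gcongr
    exact hP.entropy_sub_le_erasureEntropyRate hΦ hT Λ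
  · dsimp only
    gcongr
    exact hP.erasureEntropyRate_le hΦ hT Λ

end BoundaryEffect

/-! ### Mixtures of translation-invariant Gibbs measures. -/

section Mixture

variable {d : ℕ} {A : Type*} [MeasurableSpace A] {P Q : Measure (Config d A)}

/-- The mixture `t P + (1 - t) Q`. -/
noncomputable abbrev mixture (t : ℝ) (P Q : Measure (Config d A)) : Measure (Config d A) :=
  ENNReal.ofReal t • P + ENNReal.ofReal (1 - t) • Q

theorem TranslationInvariant.mixture (hP : TranslationInvariant P) (hQ : TranslationInvariant Q)
    (t : ℝ) : TranslationInvariant (mixture t P Q) := by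
  intro k
  have hm : Measurable (fun (x : Config d A) i => x (i + k)) :=
    measurable_pi_iff.2 fun i => measurable_pi_apply _
  rw [Measure.map_add _ _ hm, Measure.map_smul, Measure.map_smul, hP k, hQ k]

theorem isProbabilityMeasure_mixture [IsProbabilityMeasure P] [IsProbabilityMeasure Q] {t : ℝ}
    (h0 : 0 ≤ t) (h1 : t ≤ 1) : IsProbabilityMeasure (mixture t P Q) := by
  constructor
  simp [← ENNReal.ofReal_add h0 (sub_nonneg.2 h1)]

theorem integral_mixture {f : Config d A → ℝ} (hP : Integrable f P) (hQ : Integrable f Q) {t : ℝ}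
    (h0 : 0 ≤ t) (h1 : t ≤ 1) :
    ∫ x, f x ∂(mixture t P Q) = t * ∫ x, f x ∂P + (1 - t) * ∫ x, f x ∂Q := by
  rw [integral_add_measure (hP.smul_measure ENNReal.ofReal_ne_top)
    (hQ.smul_measure ENNReal.ofReal_ne_top), integral_smul_measure, integral_smul_measure,
    ENNReal.toReal_ofReal h0, ENNReal.toReal_ofReal (sub_nonneg.2 h1), smul_eq_mul, smul_eq_mul]

/-- Tested on exterior events, the DLR equation equates two integrals against the measure, with
integrands that do not depend on it, so it passes to mixtures. -/
theorem IsGibbs.mixture [Fintype A] [MeasurableSingletonClass A] {Φ : Interaction d A}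
    (hP : IsGibbs Φ P) (hQ : IsGibbs Φ Q) {t : ℝ} (h0 : 0 ≤ t) (h1 : t ≤ 1) :
    IsGibbs Φ (mixture t P Q) := by
  have := hP.isProbabilityMeasure
  have := hQ.isProbabilityMeasure
  have hR := isProbabilityMeasure_mixture (P := P) (Q := Q) h0 h1
  refine ⟨hR, fun Λ ξ => ?_⟩
  have hm := measurableSet_restrict_eq Λ ξ
  have hind : ∀ (R : Measure (Config d A)) [IsFiniteMeasure R],
      Integrable (Set.indicator {x | Λ.restrict x = ξ} fun _ => (1 : ℝ)) R := fun R _ =>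
    (integrable_const _).indicator hm
  refine (ae_eq_condExp_of_forall_setIntegral_eq cylinderEvents_le_pi (hind _)
    (fun s _ _ => (integrable_gibbsSpec Φ Λ ξ _).integrableOn) (fun s hs _ => ?_)
    (measurable_gibbsSpec Φ Λ ξ).stronglyMeasurable.aestronglyMeasurable).symm
  have hs' : MeasurableSet s := cylinderEvents_le_pi _ hs
  have hspec : ∀ {μ : Measure (Config d A)}, IsGibbs Φ μ →
      ∫ x, s.indicator (gibbsSpec Φ Λ ξ) x ∂μ =
        ∫ x, s.indicator (Set.indicator {x | Λ.restrict x = ξ} fun _ => (1 : ℝ)) x ∂μ := by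
    intro μ hμ
    rw [integral_indicator hs', integral_indicator hs', hμ.setIntegral_gibbsSpec Λ ξ hs,
      integral_indicator hm, setIntegral_const, measureReal_restrict_apply hm, smul_eq_mul,
      mul_one]
  -- Set integrals become integrals of indicators so that `integral_mixture` applies.
  rw [← integral_indicator hs', ← integral_indicator hs',
    integral_mixture ((integrable_gibbsSpec Φ Λ ξ P).indicator hs')
      ((integrable_gibbsSpec Φ Λ ξ Q).indicator hs') h0 h1,
    integral_mixture ((hind P).indicator hs') ((hind Q).indicator hs') h0 h1, hspec hP, hspec hQ]

end Mixture

end ErasureEntropy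

theorem theorem3p3 (d : ℕ) (A : Type*) [Fintype A] [MeasurableSpace A]
    [MeasurableSingletonClass A] (Φ : Interaction d A) (hΦ : AbsolutelySummable Φ) :
    -- the erasure entropy rate exists and is given by the Gibbs specification
    (∀ P : Measure (Config d A), IsGibbs Φ P → TranslationInvariant P →
      ∀ Λ : Finset (Site d),
        Tendsto (meanErasureEntropy P Λ) (vanHove d) (𝓝 (erasureEntropyRate P Λ)) ∧
        Integrable (fun x => Real.log (gibbsSpec Φ Λ (Λ.restrict x) x)) P ∧
        erasureEntropyRate P Λ = -∫ x, Real.log (gibbsSpec Φ Λ (Λ.restrict x) x) ∂P) ∧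
    -- it is affine on the convex set of translation-invariant Gibbs measures
    (∀ P Q : Measure (Config d A), IsGibbs Φ P → TranslationInvariant P →
      IsGibbs Φ Q → TranslationInvariant Q → ∀ t : ℝ, 0 ≤ t → t ≤ 1 →
        IsGibbs Φ (ENNReal.ofReal t • P + ENNReal.ofReal (1 - t) • Q) ∧
        TranslationInvariant (ENNReal.ofReal t • P + ENNReal.ofReal (1 - t) • Q) ∧
        ∀ Λ : Finset (Site d),
          erasureEntropyRate (ENNReal.ofReal t • P + ENNReal.ofReal (1 - t) • Q) Λ =
            t * erasureEntropyRate P Λ + (1 - t) * erasureEntropyRate Q Λ) ∧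
    -- normalized by the volume, it converges to the entropy density
    (∀ P : Measure (Config d A), IsGibbs Φ P → TranslationInvariant P →
      Tendsto (fun V => entropy P V / V.card) (vanHove d) (𝓝 (entropyDensity P)) ∧
      Tendsto (fun Λ => erasureEntropyRate P Λ / Λ.card) (vanHove d)
        (𝓝 (entropyDensity P))) := by
  refine ⟨fun P hP hT Λ => ?_, fun P Q hP hPT hQ hQT t h0 h1 => ?_, fun P hP hT => ?_⟩
  · have h := hP.erasureEntropyRate_eq hΦ hT Λ
    refine ⟨?_, hP.integrable_log_gibbsDensity hΦ Λ, h⟩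
    rw [h]
    exact hP.tendsto_meanErasureEntropy hΦ hT Λ
  · have hR := hP.mixture hQ h0 h1
    have hRT := hPT.mixture hQT t
    refine ⟨hR, hRT, fun Λ => ?_⟩
    rw [hR.erasureEntropyRate_eq hΦ hRT, hP.erasureEntropyRate_eq hΦ hPT,
      hQ.erasureEntropyRate_eq hΦ hQT, integral_mixture (hP.integrable_log_gibbsDensity hΦ Λ)
      (hQ.integrable_log_gibbsDensity hΦ Λ) h0 h1]
    ring
  · exact ⟨hP.tendsto_entropy_div_card hΦ hT, hP.tendsto_erasureEntropyRate_div_card hΦ hT⟩
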